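/- All rings are commutative with $1$; a local ring is a ring with exactly one maximal ideal (not necessarily Noetherian). An ideal is regular if it contains a nonzerodivisor, and stable if it is projective as a module over its ring of endomorphisms. A ring is finitely stable if each of its finitely generated regular ideals is stable. An extension of rings $R \subseteq S$ is quadratic if $xy \in xR + yR + R$ for all $x, y \in S$. For a ring $R$ with total ring of quotients $Q(R)$ whose Jacobson radical $\operatorname{Jac} R$ is regular, put $R_0 = R$, $R_i = \{q \in Q(R) : q \operatorname{Jac} R_{i-1} \subseteq \operatorname{Jac} R_{i-1}\}$ for $i \ge 1$ (this is the endomorphism ring of $\operatorname{Jac} R_{i-1}$), and $R_\infty = \bigcup_{i \ge 1} R_i$. Such an $R$ is a quadratic ring if it is local, $R \subseteq R_\infty$ is a quadratic extension, and the maximal ideal of $R$ is stable and regular. **Theorem.** Let $R$ be a finitely stable local ring whose maximal ideal is stable and regular. Then $R$ is a quadratic ring, and $R_\infty$ has at most two maximal ideals. -/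

import Mathlib

open scoped nonZeroDivisors

namespace StableRings

section Ideals

variable {R : Type*} [CommRing R]

/-- An ideal is regular if it contains a nonzerodivisor. -/
def IsRegularIdeal (I : Ideal R) : Prop :=
  ∃ x ∈ I, x ∈ R⁰

/-- An ideal is stable if it is projective over its ring of endomorphisms. -/
def IsStableIdeal (I : Ideal R) : Prop :=
  Module.Projective (Module.End R I) I

variable (R) in
/-- A ring is finitely stable if each of its finitely generated regular ideals is stable. -/
def IsFinitelyStable : Prop :=
  ∀ I : Ideal R, I.FG → IsRegularIdeal I → IsStableIdeal I

end Ideals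

/-- `S` is a quadratic extension of `R`: `R` embeds into `S`, and `x y ∈ x R + y R + R`
for all `x, y ∈ S`. -/
structure IsQuadraticExtension (R S : Type*) [CommRing R] [CommRing S] [Algebra R S] : Prop where
  injective : Function.Injective (algebraMap R S)
  mul_mem : ∀ x y : S, ∃ a b c : R, x * y = a • x + b • y + algebraMap R S c

section Tower

variable {R K : Type*} [CommRing R] [CommRing K] [Algebra R K]

/-- The ring `E(I) = {q ∈ K : q I ⊆ I}`, for an `R`-submodule `I` of `K`. -/
def endRing (I : Submodule R K) : Subalgebra R K where
  carrier := {q | ∀ x ∈ I, q * x ∈ I}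
  mul_mem' {a b} ha hb x hx := by
    rw [mul_assoc]
    exact ha _ (hb _ hx)
  add_mem' {a b} ha hb x hx := by
    rw [add_mul]
    exact I.add_mem (ha _ hx) (hb _ hx)
  algebraMap_mem' r x hx := by
    rw [← Algebra.smul_def]
    exact I.smul_mem r hx

/-- The Jacobson radical of an intermediate ring `A` of `K / R`, as an `R`-submodule of `K`. -/
def jac (A : Subalgebra R K) : Submodule R K :=
  ((Ring.jacobson A).restrictScalars R).map A.val.toLinearMap

theorem mem_jac {A : Subalgebra R K} {x : K} :
    x ∈ jac A ↔ ∃ y : A, y ∈ Ring.jacobson A ∧ (y : K) = x :=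
  Iff.rfl

variable (R K) in
/-- The tower of rings `R₀ = R`, `Rᵢ₊₁ = E(Jac Rᵢ)`, inside `K`
(which is meant to be the total ring of quotients of `R`). -/
def tower : ℕ → Subalgebra R K
  | 0 => ⊥
  | i + 1 => endRing (jac (tower i))

theorem le_endRing_jac (A : Subalgebra R K) : A ≤ endRing (jac A) := by
  rintro a ha x hx
  obtain ⟨y, hy, rfl⟩ := mem_jac.1 hx
  exact mem_jac.2 ⟨⟨a, ha⟩ * y, Ideal.mul_mem_left _ _ hy, rfl⟩

theorem tower_mono : Monotone (tower R K) :=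
  monotone_nat_of_le_succ fun i => le_endRing_jac (tower R K i)

variable (R K) in
/-- The union `R_∞` of the rings `R₁ ⊆ R₂ ⊆ ⋯` of the tower. -/
def towerUnion : Subalgebra R K where
  carrier := ⋃ i : ℕ, (tower R K (i + 1) : Set K)
  mul_mem' {a b} ha hb := by
    obtain ⟨i, hi⟩ := Set.mem_iUnion.1 ha
    obtain ⟨j, hj⟩ := Set.mem_iUnion.1 hb
    exact Set.mem_iUnion.2 ⟨max i j, mul_mem (tower_mono (by omega) hi) (tower_mono (by omega) hj)⟩
  add_mem' {a b} ha hb := by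
    obtain ⟨i, hi⟩ := Set.mem_iUnion.1 ha
    obtain ⟨j, hj⟩ := Set.mem_iUnion.1 hb
    exact Set.mem_iUnion.2 ⟨max i j, add_mem (tower_mono (by omega) hi) (tower_mono (by omega) hj)⟩
  algebraMap_mem' r := Set.mem_iUnion.2 ⟨0, Subalgebra.algebraMap_mem _ r⟩

end Tower

/-- A ring `R` with total ring of quotients `K` is a quadratic ring if it is local, `R ⊆ R_∞` is a
quadratic extension, and the maximal ideal of `R` is stable and regular. -/
structure IsQuadraticRing (R K : Type*) [CommRing R] [CommRing K] [Algebra R K]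
    [IsFractionRing R K] : Prop extends IsLocalRing R where
  quadratic : IsQuadraticExtension R (towerUnion R K)
  stable : IsStableIdeal (IsLocalRing.maximalIdeal R)
  regular : IsRegularIdeal (IsLocalRing.maximalIdeal R)

end StableRings

/-!
Let `I` be a finitely generated submodule of `K` that contains a unit. Finite stability makes `I`
invertible over `E(I)`, hence `E(I) = I⁻¹ I` is a finite `R`-module, hence a semilocal ring, hence
`I` is principal over `E(I)`. Everything else is read off a generator of a well-chosen `I`.

For `I = R x + R` it yields that every `x ∈ K` is a root of a polynomial of degree at most two over
`R` with a unit coefficient. If `A` is integral over `R`, such an equation for `x ∈ E(Jac A)` can be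
reduced modulo `Jac A`, which contains the maximal ideal of `R`, and shows that `x` is integral.
So `R_∞` is integral over `R`.

For `x, y` in an integral extension and `I = R x + R y + R`, a generator of `I` is a unit of `E(I)`,
because its inverse lies in `E(I)` and it is integral. So `I = E(I)` is a ring and contains `x y`.

Finally, suppose that an integral extension has three maximal ideals. Choose `x ≡ (1, 1, 0)` and
`y ≡ (0, 1, 1)` modulo them and a regular `m` in the maximal ideal of `R`. A generator
`r x + s y + t m` of `I = R x + R y + R m` divides `x²` and `y²`, so it avoids the three ideals:
`r`, `r + s` and `s` are units, and `0`, `r`, `r + s` are distinct residues. An element that reduces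
to three distinct residues modulo the three ideals cannot satisfy a monic quadratic equation
over `R`, but `R_∞` is quadratic over `R`.
-/

namespace StableRings

section IntegralExtensions

open IsLocalRing

theorem moduleFinite_of_invertible (R E M : Type*) [CommRing R] [CommRing E] [Algebra R E]
    [AddCommGroup M] [Module R M] [Module E M] [IsScalarTower R E M] [Module.Finite R M]
    [Module.Invertible E M] : Module.Finite R E := by
  obtain ⟨s, hs⟩ := ((Module.Invertible.linearEquiv E M).symm 1).exists_finset
  have hone : ∑ p ∈ s, p.1 p.2 = 1 := by
    simpa [Module.Invertible.linearEquiv] using ((LinearEquiv.symm_apply_eq _).mp hs).symm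
  let φ : (s → M) →ₗ[R] E := ∑ p : s, (p.1.1.restrictScalars R) ∘ₗ LinearMap.proj p
  refine Module.Finite.of_surjective φ fun e => ⟨fun p => e • p.1.2, ?_⟩
  calc φ (fun p => e • p.1.2) = ∑ p : s, e * p.1.1 p.1.2 := by simp [φ]
    _ = e := by rw [← Finset.mul_sum, Finset.sum_coe_sort s fun p => p.1 p.2, hone, mul_one]

theorem finite_maximalSpectrum (R S : Type*) [CommRing R] [IsLocalRing R] [CommRing S]
    [Algebra R S] [Module.Finite R S] : Finite (MaximalSpectrum S) := by
  have hfin := Algebra.QuasiFinite.finite_primesOver (S := S) (maximalIdeal R)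
  have : Set.Finite {I : Ideal S | I.IsMaximal} := hfin.subset fun N hN => by
    have hN : N.IsMaximal := hN
    have hcomap : (N.comap (algebraMap R S)).IsMaximal :=
      Ideal.isMaximal_comap_of_isIntegral_of_isMaximal N
    exact ⟨hN.isPrime, ⟨(eq_maximalIdeal hcomap).symm⟩⟩
  have : Finite {I : Ideal S // I.IsMaximal} := this.to_subtype
  exact Finite.of_equiv _ (MaximalSpectrum.equivSubtype S).symm

theorem exists_eq_span_singleton_of_isUnit {A K : Type*} [CommRing A] [CommRing K] [Algebra A K]
    [FaithfulSMul A K] [Finite (MaximalSpectrum A)] {I : Submodule A K} (hI : IsUnit I) :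
    ∃ z, I = Submodule.span A {z} := by
  obtain ⟨u, rfl⟩ := hI
  have hu : u ∈ (Submodule.unitsToPic A K).ker := Subsingleton.elim _ _
  rw [Submodule.ker_unitsToPic] at hu
  obtain ⟨v, rfl⟩ := hu
  exact ⟨v, rfl⟩

variable {R K : Type*} [CommRing R] [CommRing K] [Algebra R K]

open Polynomial in
theorem isIntegral_of_quadratic_eq_zero {a b c : R} {x : K} (ha : IsUnit a)
    (hx : a • x ^ 2 + b • x + c • (1 : K) = 0) : IsIntegral R x := by
  obtain ⟨s, hs⟩ := ha.exists_left_inv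
  have hx' : s • (a • x ^ 2 + b • x + c • (1 : K)) = 0 := by rw [hx, smul_zero]
  simp only [smul_add, smul_smul, hs, one_smul] at hx'
  refine ⟨X ^ 2 + C (s * b) * X + C (s * c), by monicity!, ?_⟩
  simpa [Algebra.smul_def] using hx'

theorem mem_of_isIntegral_of_mul_eq_one {S : Subalgebra R K} {y z : K} (hy : y ∈ S)
    (hz : IsIntegral R z) (hyz : y * z = 1) : z ∈ S := by
  have hloc : IsLocalHom (algebraMap S (integralClosure S K)) :=
    (algebraMap_isIntegral_iff.2 inferInstance).isLocalHom fun a b hab =>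
      Subtype.ext (congr_arg (fun c : integralClosure S K => (c : K)) hab)
  have hyu : IsUnit (algebraMap S (integralClosure S K) ⟨y, hy⟩) :=
    .of_mul_eq_one ⟨z, hz.tower_top⟩ (Subtype.ext hyz)
  obtain ⟨w, hw⟩ := (hloc.map_nonunit _ hyu).exists_left_inv
  have hwz : (w : K) = z := left_inv_eq_right_inv (congr_arg Subtype.val hw) hyz
  exact hwz ▸ w.2

theorem algebraMap_mem_jacobson {A : Type*} [CommRing A] [Algebra R A] [Algebra.IsIntegral R A]
    {r : R} (hr : r ∈ Ring.jacobson R) : algebraMap R A r ∈ Ring.jacobson A := by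
  rw [Ring.jacobson_eq_sInf_isMaximal, Submodule.mem_sInf] at hr ⊢
  intro (N : Ideal A) (hN : N.IsMaximal)
  exact hr (N.comap (algebraMap R A)) (Ideal.isMaximal_comap_of_isIntegral_of_isMaximal N)

theorem mem_iff_residue_eq_zero [IsLocalRing R] {S : Type*} [CommRing S] [Algebra R S]
    [Algebra.IsIntegral R S] {N : Ideal S} [N.IsMaximal] {x : S} {r : R}
    (hx : x - algebraMap R S r ∈ N) : x ∈ N ↔ residue R r = 0 := by
  rw [residue_eq_zero_iff,
    ← eq_maximalIdeal (Ideal.isMaximal_comap_of_isIntegral_of_isMaximal (R := R) N),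
    Ideal.mem_comap, ← N.add_mem_iff_right (b := algebraMap R S r) hx, sub_add_cancel]

end IntegralExtensions

section EndPrincipal

variable {R K : Type*} [CommRing R] [CommRing K] [Algebra R K]

/-- A submodule `I` of `K` is principal over its endomorphism ring `E(I)`: `I = E(I) z` for some
`z ∈ I`. -/
def IsEndPrincipal (I : Submodule R K) : Prop :=
  ∃ z ∈ I, ∀ x ∈ I, ∃ q ∈ endRing I, x = q * z

variable (R K) in
/-- Every finitely generated regular fractional ideal of `R` is principal over its endomorphism
ring. When `K` is the total ring of quotients of `R`, the finitely generated fractional ideals are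
the finitely generated submodules of `K`, and the regular ones are those containing a unit. -/
def HasEndPrincipalFractionalIdeals : Prop :=
  ∀ I : Submodule R K, I.FG → (∃ u ∈ I, IsUnit u) → IsEndPrincipal I

/-- A submodule `I` of `K`, viewed as a submodule over its endomorphism ring `E(I)`. -/
def overEndRing (I : Submodule R K) : Submodule (endRing I) K where
  carrier := I
  add_mem' := I.add_mem
  zero_mem' := I.zero_mem
  smul_mem' q _ hx := q.2 _ hx

open Pointwise in
theorem IsEndPrincipal.of_smul {I : Submodule R K} {d : R} (hd : IsUnit (algebraMap R K d))
    (h : IsEndPrincipal (d • I)) : IsEndPrincipal I := by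
  have hE : endRing (d • I) ≤ endRing I := by
    intro q hq x hx
    obtain ⟨y, hy, hyx⟩ := (Submodule.mem_smul_pointwise_iff_exists _ _ _).1
      (hq _ (Submodule.smul_mem_pointwise_smul x d I hx))
    rw [mul_smul_comm, Algebra.smul_def, Algebra.smul_def] at hyx
    exact hd.mul_left_cancel hyx ▸ hy
  obtain ⟨z, hz, hzI⟩ := h
  obtain ⟨w, hw, rfl⟩ := (Submodule.mem_smul_pointwise_iff_exists _ _ _).1 hz
  refine ⟨w, hw, fun x hx => ?_⟩
  obtain ⟨q, hq, hqx⟩ := hzI _ (Submodule.smul_mem_pointwise_smul x d I hx)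
  rw [mul_smul_comm, Algebra.smul_def, Algebra.smul_def] at hqx
  exact ⟨q, hE hq, hd.mul_left_cancel hqx⟩

theorem isEndPrincipal_of_isUnit_overEndRing [IsLocalRing R] {I : Submodule R K} (hfg : I.FG)
    (hI : IsUnit (overEndRing I)) : IsEndPrincipal I := by
  have : Module.Finite R (overEndRing I) := Module.Finite.iff_fg.2 hfg
  have : Module.Invertible (endRing I) (overEndRing I) :=
    inferInstanceAs (Module.Invertible (endRing I) (hI.unit : Submodule (endRing I) K))
  have := moduleFinite_of_invertible R (endRing I) (overEndRing I)
  have := finite_maximalSpectrum R (endRing I)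
  obtain ⟨z, hz⟩ := exists_eq_span_singleton_of_isUnit hI
  have hmem (x : K) : x ∈ I ↔ ∃ q : endRing I, q • z = x := by
    rw [← Submodule.mem_span_singleton, ← hz]
    exact Iff.rfl
  refine ⟨z, (hmem z).2 ⟨1, one_smul _ z⟩, fun x hx => ?_⟩
  obtain ⟨q, hq⟩ := (hmem x).1 hx
  exact ⟨q, q.2, hq.symm⟩

end EndPrincipal

section Stable

theorem smul_map_comm {R M : Type*} [CommRing R] [AddCommGroup M] [Module R M] {J : Ideal R}
    (f : J →ₗ[R] M) (x y : J) : (x : R) • f y = (y : R) • f x := by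
  rw [← f.map_smul, ← f.map_smul]
  exact congr_arg f (Subtype.ext (mul_comm _ _))

variable {R K : Type*} [CommRing R] [CommRing K] [Algebra R K] [IsFractionRing R K]

theorem exists_algebraMap_eq_mul_mul {J : Ideal R} (hJ : IsRegularIdeal J)
    (β : J →ₗ[R] J →ₗ[R] J) :
    ∃ q : K, ∀ x y : J, algebraMap R K (β x y) = q * algebraMap R K x * algebraMap R K y := by
  obtain ⟨r, hrJ, hr⟩ := hJ
  lift r to J using hrJ
  obtain ⟨s, hs⟩ := (IsLocalization.map_units K (⟨r, hr⟩ : R⁰)).exists_left_inv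
  have hcomm (f : J →ₗ[R] J) (x : J) :
      algebraMap R K (f x) = s * algebraMap R K x * algebraMap R K (f r) := by
    have := congr_arg (fun z : J => algebraMap R K z) (smul_map_comm f r x)
    simp only [Submodule.coe_smul, smul_eq_mul, map_mul] at this
    linear_combination s * this - algebraMap R K (f x) * hs
  refine ⟨s * s * algebraMap R K (β r r), fun x y => ?_⟩
  rw [hcomm (β x) y, ← β.flip_apply, hcomm (β.flip r) x, β.flip_apply]
  ring

theorem IsStableIdeal.isUnit_overEndRing {J : Ideal R} (hJ : IsStableIdeal J)
    (hreg : IsRegularIdeal J) :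
    IsUnit (overEndRing (Submodule.map (Algebra.linearMap R K) J)) := by
  obtain ⟨σ, hσ⟩ := hJ.out
  let β (e : J) : J →ₗ[R] J →ₗ[R] J := ((Finsupp.lapply e) ∘ₗ σ).restrictScalars R
  choose q hq using fun e => exists_algebraMap_eq_mul_mul (K := K) hreg (β e)
  have hq_mem (e : J) : q e ∈ 1 / overEndRing (Submodule.map (Algebra.linearMap R K) J) := by
    refine Submodule.mem_div_iff_forall_mul_mem.2 ?_
    rintro _ ⟨y, hy, rfl⟩
    refine Submodule.mem_one.2 ⟨⟨q e * algebraMap R K y, ?_⟩, rfl⟩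
    rintro _ ⟨x, hx, rfl⟩
    exact ⟨β e ⟨y, hy⟩ ⟨x, hx⟩, (β e ⟨y, hy⟩ ⟨x, hx⟩).2, hq e ⟨y, hy⟩ ⟨x, hx⟩⟩
  obtain ⟨r, hrJ, hr⟩ := hreg
  lift r to J using hrJ
  have hdual : ∑ e ∈ (σ r).support, (β e r e : R) = r := by
    conv_rhs => rw [← hσ r]
    simp [Finsupp.linearCombination_apply, Finsupp.sum, β]
  have hsum : ∑ e ∈ (σ r).support, algebraMap R K e * q e = 1 := by
    refine (IsLocalization.map_units K (⟨r, hr⟩ : R⁰)).mul_left_cancel ?_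
    calc algebraMap R K r * ∑ e ∈ (σ r).support, algebraMap R K e * q e
        = ∑ e ∈ (σ r).support, algebraMap R K (β e r e) := by
          simp only [Finset.mul_sum, hq]
          exact Finset.sum_congr rfl fun e _ => by ring
      _ = algebraMap R K r * 1 := by rw [← map_sum, hdual, mul_one]
  refine .of_mul_eq_one _ (le_antisymm Submodule.mul_one_div_le_one (Submodule.one_le.2 ?_))
  rw [← hsum]
  exact sum_mem fun e _ => Submodule.mul_mem_mul ⟨e, e.2, rfl⟩ (hq_mem e)

open Pointwise in
theorem IsFinitelyStable.hasEndPrincipalFractionalIdeals [IsLocalRing R]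
    (hR : IsFinitelyStable R) : HasEndPrincipalFractionalIdeals R K := by
  rintro I hfg ⟨u, huI, hu⟩
  let F : FractionalIdeal R⁰ K := ⟨I, FractionalIdeal.isFractional_of_fg hfg⟩
  have hnum : (F.den : R) • I = Submodule.map (Algebra.linearMap R K) F.num :=
    F.den_mul_self_eq_num
  have hden : IsUnit (algebraMap R K F.den) := IsLocalization.map_units K F.den
  have hnumfg : (Submodule.map (Algebra.linearMap R K) F.num).FG :=
    hnum ▸ hfg.map (DistribSMul.toLinearMap R K (F.den : R))
  have hinj : Function.Injective (Algebra.linearMap R K) := IsFractionRing.injective R K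
  have hreg : IsRegularIdeal F.num := by
    obtain ⟨r, hr, hru⟩ := hnum.le (Submodule.smul_mem_pointwise_smul u _ I huI)
    have hunit : IsUnit (algebraMap R K r) := by
      rw [← Algebra.linearMap_apply, hru, Algebra.smul_def]
      exact hden.mul hu
    exact ⟨r, hr, mem_nonZeroDivisors_of_injective (IsFractionRing.injective R K)
      hunit.mem_nonZeroDivisors⟩
  refine .of_smul hden (hnum ▸ isEndPrincipal_of_isUnit_overEndRing hnumfg ?_)
  exact (hR _ (Submodule.fg_of_fg_map_injective _ hinj hnumfg) hreg).isUnit_overEndRing hreg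

end Stable

section Jacobson

variable {R K : Type*} [CommRing R] [CommRing K] [Algebra R K]

theorem one_notMem_jac [Nontrivial K] (A : Subalgebra R K) : (1 : K) ∉ jac A := by
  rintro ⟨y, hy, hy1⟩
  obtain rfl : y = 1 := Subtype.ext hy1
  exact (Ring.jacobson_lt_top A).ne ((Ideal.eq_top_iff_one _).2 hy)

theorem jac_le (A : Subalgebra R K) : jac A ≤ A.toSubmodule := by
  rintro _ ⟨y, -, rfl⟩
  exact y.2

theorem algebraMap_mem_jac {A : Subalgebra R K} [Algebra.IsIntegral R A] {r : R}
    (hr : r ∈ Ring.jacobson R) : algebraMap R K r ∈ jac A :=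
  mem_jac.2 ⟨algebraMap R A r, algebraMap_mem_jacobson hr, rfl⟩

end Jacobson

namespace HasEndPrincipalFractionalIdeals

variable {R K : Type*} [CommRing R] [CommRing K] [Algebra R K]
  (h : HasEndPrincipalFractionalIdeals R K)
include h

theorem isQuadraticExtension [FaithfulSMul R K] (S : Subalgebra R K) [Algebra.IsIntegral R S] :
    IsQuadraticExtension R S := by
  refine ⟨fun a b hab => FaithfulSMul.algebraMap_injective R K (congr_arg S.val hab),
    fun x y => ?_⟩
  let I : Submodule R K := Submodule.span R {(x : K), (y : K), 1}
  have hxI : (x : K) ∈ I := Submodule.subset_span (by simp)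
  have hyI : (y : K) ∈ I := Submodule.subset_span (by simp)
  have hone : (1 : K) ∈ I := Submodule.subset_span (by simp)
  have hIS : I ≤ S.toSubmodule := Submodule.span_le.2 (by simp [Set.insert_subset_iff])
  obtain ⟨z, hz, hI⟩ := h I (Submodule.fg_span (by simp)) ⟨1, hone, isUnit_one⟩
  obtain ⟨q, hq, hqz⟩ := hI 1 hone
  have hzint : IsIntegral R z := (Algebra.IsIntegral.isIntegral (⟨z, hIS hz⟩ : S)).map S.val
  have hzE : z ∈ endRing I := mem_of_isIntegral_of_mul_eq_one hq hzint hqz.symm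
  obtain ⟨p, hp, hpx⟩ := hI x hxI
  have hxE : (x : K) ∈ endRing I := hpx ▸ mul_mem hp hzE
  obtain ⟨a, b, c, habc⟩ := Submodule.mem_span_triple.1 (hxE y hyI)
  exact ⟨a, b, c, Subtype.ext (by simpa [Algebra.algebraMap_eq_smul_one] using habc.symm)⟩

theorem exists_quadratic_eq_zero [IsLocalRing R] (x : K) :
    ∃ a b c : R, a • x ^ 2 + b • x + c • (1 : K) = 0 ∧ (IsUnit a ∨ IsUnit b ∨ IsUnit c) := by
  let I : Submodule R K := Submodule.span R {x, 1}
  have hxI : x ∈ I := Submodule.subset_span (by simp)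
  have hone : (1 : K) ∈ I := Submodule.subset_span (by simp)
  have hEI {q : K} (hq : q ∈ endRing I) : ∃ a b : R, a • x + b • (1 : K) = q :=
    Submodule.mem_span_pair.1 (mul_one q ▸ hq 1 hone)
  obtain ⟨z, hz, hI⟩ := h I (Submodule.fg_span (by simp)) ⟨1, hone, isUnit_one⟩
  obtain ⟨p, hp, hpz⟩ := hI x hxI
  obtain ⟨q, hq, hqz⟩ := hI 1 hone
  obtain ⟨a, b, hab⟩ := hEI hp
  obtain ⟨c, d, hcd⟩ := hEI hq
  obtain ⟨e, f, hef⟩ := Submodule.mem_span_pair.1 hz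
  obtain ⟨s, t, hst⟩ := Submodule.mem_span_pair.1 (hp x hxI)
  -- The cases use `x = (a x + b) (e x + f)`, `1 = (c x + d) (e x + f)` and `(a x + b) x = s x + t`.
  simp only [← IsLocalRing.residue_ne_zero_iff_isUnit]
  simp only [Algebra.smul_def, mul_one] at hab hcd hef hst ⊢
  by_cases ha : IsLocalRing.residue R a = 0
  · by_cases he : IsLocalRing.residue R e = 0
    · refine ⟨a * e, a * f + b * e - 1, b * f, ?_, .inr (.inl (by simp [ha, he]))⟩
      rw [← hab, ← hef] at hpz
      simp only [map_add, map_sub, map_mul, map_one]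
      linear_combination -hpz
    · refine ⟨c * e, c * f + d * e, d * f - 1, ?_, ?_⟩
      · rw [← hcd, ← hef] at hqz
        simp only [map_add, map_sub, map_mul, map_one]
        linear_combination -hqz
      · simp only [map_add, map_sub, map_mul, map_one]
        grind
  · refine ⟨a, b - s, -t, ?_, .inl ha⟩
    rw [← hab] at hst
    simp only [map_sub, map_neg]
    linear_combination -hst

theorem isIntegral_endRing_jac [IsLocalRing R] [Nontrivial K] {A : Subalgebra R K}
    [Algebra.IsIntegral R A] : Algebra.IsIntegral R (endRing (jac A)) := by
  refine (Subalgebra.isIntegral_iff _).2 fun x hx => ?_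
  have hmul {r : R} (hr : ¬ IsUnit r) : r • x ∈ jac A := by
    have hrJ : r ∈ Ring.jacobson R := by
      rwa [IsLocalRing.ringJacobson_eq_maximalIdeal, IsLocalRing.mem_maximalIdeal]
    rw [Algebra.smul_def, mul_comm]
    exact hx _ (algebraMap_mem_jac hrJ)
  obtain ⟨a, b, c, habc, hunit⟩ := h.exists_quadratic_eq_zero x
  by_cases ha : IsUnit a
  · exact isIntegral_of_quadratic_eq_zero ha habc
  have hax : a • x ^ 2 ∈ jac A := by
    rw [pow_two, ← mul_smul_comm]
    exact hx _ (hmul ha)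
  by_cases hb : IsUnit b
  · have hbx : b • x ∈ A := by
      rw [show b • x = -(a • x ^ 2) - c • 1 by linear_combination habc]
      exact sub_mem (neg_mem (jac_le A hax)) (A.smul_mem A.one_mem c)
    have hxA : x ∈ A := (A.toSubmodule.smul_mem_iff_of_isUnit hb).1 hbx
    exact (Algebra.IsIntegral.isIntegral (⟨x, hxA⟩ : A)).map A.val
  · have hc : c • (1 : K) ∈ jac A := by
      rw [show c • (1 : K) = -(a • x ^ 2 + b • x) by linear_combination habc]
      exact neg_mem (add_mem hax (hmul hb))
    have hcu : IsUnit c := (hunit.resolve_left ha).resolve_left hb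
    exact absurd ((Submodule.smul_mem_iff_of_isUnit _ hcu).1 hc) (one_notMem_jac A)

theorem isIntegral_tower [IsLocalRing R] [Nontrivial K] (n : ℕ) :
    Algebra.IsIntegral R (tower R K n) := by
  induction n with
  | zero => exact inferInstanceAs (Algebra.IsIntegral R (⊥ : Subalgebra R K))
  | succ n ih => exact h.isIntegral_endRing_jac

theorem isIntegral_towerUnion [IsLocalRing R] [Nontrivial K] :
    Algebra.IsIntegral R (towerUnion R K) := by
  refine (Subalgebra.isIntegral_iff _).2 fun x hx => ?_
  obtain ⟨n, hn⟩ := Set.mem_iUnion.1 hx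
  exact (Subalgebra.isIntegral_iff _).1 (h.isIntegral_tower (n + 1)) x hn

theorem exists_dvd_sq {m : R} (hm : IsUnit (algebraMap R K m)) {S : Subalgebra R K} (x y : S) :
    ∃ r s t : R, r • x + s • y + t • algebraMap R S m ∣ x ^ 2 ∧
      r • x + s • y + t • algebraMap R S m ∣ y ^ 2 := by
  let I : Submodule R K := Submodule.span R {(x : K), (y : K), algebraMap R K m}
  have hIS : I ≤ S.toSubmodule := Submodule.span_le.2 (by simp [Set.insert_subset_iff])
  obtain ⟨z, hz, hI⟩ := h I (Submodule.fg_span (by simp))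
    ⟨algebraMap R K m, Submodule.subset_span (by simp), hm⟩
  obtain ⟨r, s, t, hrst⟩ := Submodule.mem_span_triple.1 hz
  have hdvd {u : S} (hu : (u : K) ∈ I) : r • x + s • y + t • algebraMap R S m ∣ u ^ 2 := by
    obtain ⟨q, hq, hqz⟩ := hI u hu
    refine ⟨⟨q * u, hIS (hq u hu)⟩, Subtype.ext ?_⟩
    calc (u : K) ^ 2 = z * (q * u) := by linear_combination (u : K) * hqz
      _ = _ := by rw [← hrst]; rfl
  exact ⟨r, s, t, hdvd (Submodule.subset_span (by simp)), hdvd (Submodule.subset_span (by simp))⟩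

end HasEndPrincipalFractionalIdeals

section MaximalIdeals

open IsLocalRing

variable {R : Type*} [CommRing R] [IsLocalRing R]

theorem IsQuadraticExtension.not_injective_residue {S : Type*} [CommRing S] [Algebra R S]
    (hS : IsQuadraticExtension R S) {P : Fin 3 → Ideal S} (hP : ∀ i, P i ≠ ⊤) {w : S}
    {a : Fin 3 → R} (hw : ∀ i, w - algebraMap R S (a i) ∈ P i) :
    ¬ Function.Injective fun i => residue R (a i) := by
  obtain ⟨b, c, d, hbcd⟩ := hS.mul_mem w w
  have hroot (i) : residue R (a i) * residue R (a i) =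
      residue R (b + c) * residue R (a i) + residue R d := by
    have hmem : algebraMap R S (a i * a i - (b + c) * a i - d) ∈ P i := by
      simp only [Algebra.smul_def] at hbcd
      have : algebraMap R S (a i * a i - (b + c) * a i - d) = (algebraMap R S (b + c) - w -
          algebraMap R S (a i)) * (w - algebraMap R S (a i)) := by
        simp only [map_sub, map_mul, map_add]
        linear_combination hbcd
      exact this ▸ Ideal.mul_mem_left _ _ (hw i)
    have := (residue_eq_zero_iff _).2
      (le_maximalIdeal (Ideal.comap_ne_top (algebraMap R S) (hP i)) hmem)
    simp only [map_sub, map_mul] at this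
    linear_combination this
  intro hinj
  have h01 := hinj.ne (show (0 : Fin 3) ≠ 1 by decide)
  have h02 := hinj.ne (show (0 : Fin 3) ≠ 2 by decide)
  have h12 := hinj.ne (show (1 : Fin 3) ≠ 2 by decide)
  have h0 := hroot 0
  have h1 := hroot 1
  have h2 := hroot 2
  grind

theorem HasEndPrincipalFractionalIdeals.exists_injective_residue {K : Type*} [CommRing K]
    [Algebra R K] (h : HasEndPrincipalFractionalIdeals R K) {m : R} (hm : m ∈ maximalIdeal R)
    (hmu : IsUnit (algebraMap R K m)) {S : Subalgebra R K} [Algebra.IsIntegral R S]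
    {P : Fin 3 → Ideal S} [∀ i, (P i).IsMaximal] (hP : Function.Injective P) :
    ∃ a : Fin 3 → R, Function.Injective fun i => residue R (a i) := by
  have hcop : Pairwise (Function.onFun IsCoprime P) := fun i j hij =>
    Ideal.isCoprime_of_isMaximal (hP.ne hij)
  let v : Fin 3 → R := ![1, 1, 0]
  let w : Fin 3 → R := ![0, 1, 1]
  obtain ⟨x, hx⟩ := Ideal.exists_forall_sub_mem_ideal hcop fun i => algebraMap R S (v i)
  obtain ⟨y, hy⟩ := Ideal.exists_forall_sub_mem_ideal hcop fun i => algebraMap R S (w i)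
  obtain ⟨r, s, t, hzx, hzy⟩ := h.exists_dvd_sq hmu x y
  set z := r • x + s • y + t • algebraMap R S m with hz
  have hzP (i) : z - algebraMap R S (r * v i + s * w i) ∈ P i := by
    have hmP : algebraMap R S m ∈ P i :=
      (mem_iff_residue_eq_zero (by simp)).2 ((residue_eq_zero_iff m).2 hm)
    have hcomb := add_mem (add_mem (Ideal.mul_mem_left _ (algebraMap R S r) (hx i))
      (Ideal.mul_mem_left _ (algebraMap R S s) (hy i)))
      (Ideal.mul_mem_left _ (algebraMap R S t) hmP)
    convert hcomb using 1
    simp only [hz, Algebra.smul_def, map_add, map_mul]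
    ring
  have hres (i) : residue R (r * v i + s * w i) ≠ 0 := by
    intro hi
    have hprime : (P i).IsPrime := inferInstance
    have hzi : z ∈ P i := (mem_iff_residue_eq_zero (hzP i)).2 hi
    have hv := (mem_iff_residue_eq_zero (hx i)).1
      (hprime.mem_of_pow_mem 2 ((P i).mem_of_dvd hzx hzi))
    have hw := (mem_iff_residue_eq_zero (hy i)).1
      (hprime.mem_of_pow_mem 2 ((P i).mem_of_dvd hzy hzi))
    fin_cases i <;> simp [v, w] at hv hw
  have hr : residue R r ≠ 0 := by simpa [v, w] using hres 0
  have hrs : residue R r + residue R s ≠ 0 := by simpa [v, w] using hres 1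
  have hs : residue R s ≠ 0 := by simpa [v, w] using hres 2
  refine ⟨![0, r, r + s], fun i j hij => ?_⟩
  fin_cases i <;> fin_cases j <;> simp [-residue_eq_zero_iff] at hij ⊢ <;> grind

theorem HasEndPrincipalFractionalIdeals.encard_isMaximal_le_two {K : Type*} [CommRing K]
    [Algebra R K] [FaithfulSMul R K] (h : HasEndPrincipalFractionalIdeals R K) {m : R}
    (hm : m ∈ maximalIdeal R) (hmu : IsUnit (algebraMap R K m)) (S : Subalgebra R K)
    [Algebra.IsIntegral R S] : {N : Ideal S | N.IsMaximal}.encard ≤ 2 := by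
  by_contra! hlt
  obtain ⟨T, hT, hcard⟩ := Set.exists_subset_encard_eq (Order.add_one_le_of_lt hlt)
  obtain ⟨N₀, N₁, N₂, h01, h02, h12, rfl⟩ := Set.encard_eq_three.1 hcard
  let P : Fin 3 → Ideal S := ![N₀, N₁, N₂]
  have hmax (i) : (P i).IsMaximal := by
    fin_cases i <;> exact hT (by simp [P])
  have hinj : Function.Injective P := by
    intro i j hij
    fin_cases i <;> fin_cases j <;> simp_all [P]
  obtain ⟨a, ha⟩ := h.exists_injective_residue hm hmu hinj
  obtain ⟨w, hw⟩ := Ideal.exists_forall_sub_mem_ideal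
    (fun i j hij => Ideal.isCoprime_of_isMaximal (hinj.ne hij)) fun i => algebraMap R S (a i)
  exact (h.isQuadraticExtension S).not_injective_residue (fun i => (hmax i).ne_top) hw ha

end MaximalIdeals

end StableRings

open StableRings in
theorem theorem3p9_general {R : Type*} [CommRing R] [IsLocalRing R]
    (K : Type*) [CommRing K] [Algebra R K] [IsFractionRing R K] (hR : IsFinitelyStable R)
    (hregular : IsRegularIdeal (IsLocalRing.maximalIdeal R)) :
    IsQuadraticExtension R (towerUnion R K) ∧
      {N : Ideal (towerUnion R K) | N.IsMaximal}.encard ≤ 2 := by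
  obtain ⟨m, hm, hreg⟩ := hregular
  have hinj := IsFractionRing.injective R K
  have := (faithfulSMul_iff_algebraMap_injective R K).2 hinj
  have := hinj.nontrivial
  have h : HasEndPrincipalFractionalIdeals R K := hR.hasEndPrincipalFractionalIdeals
  have := h.isIntegral_towerUnion
  exact ⟨h.isQuadraticExtension _,
    h.encard_isMaximal_le_two hm (IsLocalization.map_units K ⟨m, hreg⟩) _⟩

/-- `K` is the total ring of quotients of `R`. -/
theorem theorem3p9 {R : Type*} [CommRing R] [IsLocalRing R]
    (K : Type*) [CommRing K] [Algebra R K] [IsFractionRing R K]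
    (hR : StableRings.IsFinitelyStable R)
    (hstable : StableRings.IsStableIdeal (IsLocalRing.maximalIdeal R))
    (hregular : StableRings.IsRegularIdeal (IsLocalRing.maximalIdeal R)) :
    StableRings.IsQuadraticRing R K ∧
      {N : Ideal (StableRings.towerUnion R K) | N.IsMaximal}.encard ≤ 2 := by
  obtain ⟨hquadratic, hcard⟩ := theorem3p9_general K hR hregular
  exact ⟨⟨‹_›, hquadratic, hstable, hregular⟩, hcard⟩
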